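/- For integers $r,s\ge 1$ and $n\ge 0$, let $a_{r,s}(n)$ denote the number of partitions of $n$ in which each even part may appear in any one of $r$ colors and each odd part may appear in any one of $s$ colors (copies of the same part size in different colors are distinct objects, the order of the parts does not matter, and $a_{r,s}(0)=1$). Then for all integers $n\ge 0$ and all integers $k\ge j\ge 0$, $$a_{9(k-j)+4,\;9k+2}(9n+7)\equiv 0 \pmod 3.$$ -/

import Mathlib

/-- The number of colors available for a part of size `m`:
`r` if `m` is even, `s` if `m` is odd. -/
def numColors (r s m : ℕ) : ℕ := if Even m then r else s

/-- The partitions of `n` with `r`-colored even parts and `s`-colored odd parts: finite multisets of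
pairs `(m, c)`, a part `m ≥ 1` together with its color `c`, which is one of the
`numColors r s m` colors `0, 1, …, numColors r s m - 1`, such that the parts sum to `n`. -/
def coloredPartitions (r s n : ℕ) : Set (Multiset (ℕ × ℕ)) :=
  {M | (∀ x ∈ M, 0 < x.1 ∧ x.2 < numColors r s x.1) ∧ (M.map Prod.fst).sum = n}

/-- There are only finitely many such partitions, so that counting them by `Set.ncard` is
meaningful. -/
theorem coloredPartitions_finite (r s n : ℕ) : (coloredPartitions r s n).Finite := by
  refine (Set.finite_Iic (n • (Finset.range (n + 1) ×ˢ Finset.range (r + s)).val)).subset ?_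
  rintro M ⟨h1, h2⟩
  have hcard : M.card ≤ n := by
    have h := Multiset.card_nsmul_le_sum (s := M.map Prod.fst) (a := 1) (by
      intro y hy
      obtain ⟨x, hx, rfl⟩ := Multiset.mem_map.1 hy
      exact (h1 x hx).1)
    simpa [h2] using h
  rw [Set.mem_Iic, Multiset.le_iff_count]
  intro x
  by_cases hx : x ∈ M
  · have hle : x.1 ≤ n := h2 ▸ Multiset.le_sum_of_mem (Multiset.mem_map_of_mem Prod.fst hx)
    have hc : x.2 < r + s := by
      have := (h1 x hx).2
      unfold numColors at this
      split_ifs at this <;> omega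
    have hmem : x ∈ Finset.range (n + 1) ×ˢ Finset.range (r + s) := by
      simp only [Finset.mem_product, Finset.mem_range]
      omega
    rw [Multiset.count_nsmul, Multiset.count_eq_one_of_mem (Finset.nodup _) hmem, mul_one]
    exact (Multiset.count_le_card x M).trans hcard
  · simp [Multiset.count_eq_zero_of_notMem hx]

/-- `a_{r,s}(n)`, the number of partitions of `n` with `r`-colored even parts and `s`-colored odd
parts. -/
noncomputable def coloredPartitionCount (r s n : ℕ) : ℕ := (coloredPartitions r s n).ncard

/-!
Write `E₁ = ∏ (1 - X ^ n)`, `E₂ = ∏ (1 - X ^ (2 n))` and `F = E₁ E₂`, with coefficients in `ZMod 3`.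
The generating function `D` of the colored partitions satisfies `D E₂ ^ r E₁ ^ s = E₂ ^ s`
(`coloredPartitionSeries_mul`). For `r = 9 (k - j) + 4` and `s = 9 k + 2` this says that `D` is
`F ^ 7` up to ninth powers, and ninth powers are series in `X ^ 9` in characteristic 3. So it is
enough that `F ^ 7` has no exponents `9 n + 7` (`seriesSection_eulerProduct_pow_seven`).

Consider the binary theta series `∑ (-1) ^ v X ^ (t (t + 1) / 2 + v ^ 2)` over `ℤ × ℤ`, split by the
class of `t + v` modulo 3. By the pentagonal number theorem and a linear change of variables, the
class 0 sums to `F` (`binaryTheta_zero`). The class 1 sums to `0`, by a sign-reversing linear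
involution (`binaryTheta_one`), and the class 2 agrees with the class 0 under the symmetries
`t ↦ -1 - t`, `v ↦ -v`. Hence the whole series, which is a product of two unary theta series,
equals `2 F = -F`.

Splitting the two unary series by residue classes gives `F = A + P + B`, with exponents in the
classes 0, 1, 2 modulo 3. The vanishing of the class 1 sum gives `A B = P ^ 2`, so that `F ^ 2` has no
exponents `3 n + 2`. Moreover `P` is `X` times the whole binary series in `X ^ 9`, that is,
`P = -X F(X ^ 9)`. As `F ^ 7 = F(X ^ 3) ^ 2 F`, its terms with exponents `3 m + 1` form the series
`-F ^ 2 F(X ^ 3)` (with `X ^ m` for `X ^ (3 m + 1)`), and those with `m = 3 n + 2` vanish because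
those of `F ^ 2` do.
-/

open PowerSeries Filter Topology
open scoped PowerSeries.WithPiTopology

/-! ### Sections of power series -/

/-- The section `∑ f_{qn+i} X^n` of a power series `∑ f_n X^n`. -/
noncomputable def seriesSection {R : Type*} [CommRing R] (q i : ℕ) (f : R⟦X⟧) : R⟦X⟧ :=
  PowerSeries.mk fun n => coeff (q * n + i) f

@[simp]
theorem coeff_seriesSection {R : Type*} [CommRing R] (q i n : ℕ) (f : R⟦X⟧) :
    coeff n (seriesSection q i f) = coeff (q * n + i) f := by
  simp [seriesSection]

/-- A factor that is a power series in `X ^ q` can be pulled out of a section modulo `q`. -/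
theorem seriesSection_mul_expand {R : Type*} [CommRing R] {q i : ℕ} (hi : i < q) (f g : R⟦X⟧) :
    seriesSection q i (f * expand q (by omega) g) = seriesSection q i f * g := by
  ext n
  rw [coeff_seriesSection, coeff_mul, coeff_mul]
  symm
  refine Finset.sum_of_injOn (fun p => (q * p.1 + i, q * p.2)) ?_ ?_ ?_ ?_
  · rintro ⟨a, b⟩ - ⟨c, d⟩ - h
    simp only [Prod.mk.injEq, Nat.add_right_cancel_iff, mul_eq_mul_left_iff] at h ⊢
    omega
  · rintro ⟨a, b⟩ h
    rw [Finset.mem_coe, Finset.HasAntidiagonal.mem_antidiagonal] at h ⊢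
    subst h
    ring
  · rintro ⟨a, b⟩ h h'
    rw [Finset.HasAntidiagonal.mem_antidiagonal] at h
    rw [coeff_expand_of_not_dvd, mul_zero]
    rintro ⟨d, rfl⟩
    change a + q * d = q * n + i at h
    have hd : d ≤ n := by
      by_contra! hlt
      have := Nat.mul_le_mul_left q (Nat.succ_le_of_lt hlt)
      rw [Nat.mul_succ] at this
      omega
    obtain ⟨c, rfl⟩ := Nat.exists_eq_add_of_le' hd
    refine h' ⟨(c, d), by simp, ?_⟩
    rw [mul_add] at h
    simp only [Prod.mk.injEq, and_true]
    omega
  · rintro ⟨a, b⟩ -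
    simp

/-- All exponents occurring in `f` lie in the residue class `c` modulo 3. -/
def ExponentsInClass {R : Type*} [CommRing R] (c : ZMod 3) (f : R⟦X⟧) : Prop :=
  ∀ n : ℕ, (n : ZMod 3) ≠ c → coeff n f = 0

theorem ExponentsInClass.mul {R : Type*} [CommRing R] {c d : ZMod 3} {f g : R⟦X⟧}
    (hf : ExponentsInClass c f) (hg : ExponentsInClass d g) :
    ExponentsInClass (c + d) (f * g) := by
  intro n hn
  rw [coeff_mul]
  refine Finset.sum_eq_zero fun p hp => ?_
  rw [Finset.HasAntidiagonal.mem_antidiagonal] at hp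
  by_cases h : (p.1 : ZMod 3) = c
  · rw [hg p.2, mul_zero]
    rintro h'
    exact hn (by rw [← hp, Nat.cast_add, h, h'])
  · rw [hf _ h, zero_mul]

theorem ExponentsInClass.seriesSection_eq_zero {R : Type*} [CommRing R] {c : ZMod 3} {f : R⟦X⟧}
    (hf : ExponentsInClass c f) {i : ℕ} (hi : (i : ZMod 3) ≠ c) : seriesSection 3 i f = 0 := by
  ext n
  rw [coeff_seriesSection, map_zero]
  refine hf _ ?_
  push_cast
  rwa [show (3 : ZMod 3) = 0 from rfl, zero_mul, zero_add]

theorem seriesSection_add {R : Type*} [CommRing R] (q i : ℕ) (f g : R⟦X⟧) :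
    seriesSection q i (f + g) = seriesSection q i f + seriesSection q i g := by
  ext n
  simp

theorem pow_three_eq_expand (f : (ZMod 3)⟦X⟧) : f ^ 3 = expand 3 (by norm_num) f := by
  have h := MvPowerSeries.map_frobenius_expand (R := ZMod 3) (σ := Unit) (f := f) 3 (by norm_num)
  rw [ZMod.frobenius_zmod] at h
  have h2 : (MvPowerSeries.map (RingHom.id (ZMod 3)) (MvPowerSeries.expand 3 (by norm_num) f) :
    MvPowerSeries Unit (ZMod 3)) = MvPowerSeries.expand 3 (by norm_num) f := by
    simp
  exact (h2.symm.trans h).symm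

theorem pow_nine_eq_expand (f : (ZMod 3)⟦X⟧) : f ^ 9 = expand 9 (by norm_num) f := by
  rw [show f ^ 9 = (f ^ 3) ^ 3 by ring, pow_three_eq_expand, pow_three_eq_expand,
    ← PowerSeries.expand_mul]

/-! ### Sums of families of power series -/

theorem summable_of_X_pow_dvd {R ι : Type*} [CommRing R] [TopologicalSpace R] {f : ι → R⟦X⟧}
    (e : ι → ℕ) (hf : ∀ i, X ^ e i ∣ f i) (he : ∀ N, {i | e i ≤ N}.Finite) : Summable f := by
  rw [WithPiTopology.summable_iff_summable_coeff]
  intro n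
  refine summable_of_hasFiniteSupport ((he n).subset fun i hi => ?_)
  by_contra h
  exact hi (X_pow_dvd_iff.1 (hf i) n (not_le.1 h))

theorem hasSum_mul_of_X_pow_dvd {R ι κ : Type*} [CommRing R] [TopologicalSpace R]
    [IsTopologicalRing R] [T3Space R] {f : ι → R⟦X⟧} {g : κ → R⟦X⟧} {s t : R⟦X⟧}
    (hf : HasSum f s) (hg : HasSum g t) (e : ι → ℕ) (d : κ → ℕ) (hfe : ∀ i, X ^ e i ∣ f i)
    (hgd : ∀ k, X ^ d k ∣ g k) (he : ∀ N, {i | e i ≤ N}.Finite) (hd : ∀ N, {k | d k ≤ N}.Finite) :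
    HasSum (fun x : ι × κ => f x.1 * g x.2) (s * t) := by
  have : T3Space R⟦X⟧ := inferInstanceAs (T3Space ((Unit →₀ ℕ) → R))
  refine hf.mul hg (summable_of_X_pow_dvd (fun x => e x.1 + d x.2) (fun x => ?_) fun N => ?_)
  · rw [pow_add]
    exact mul_dvd_mul (hfe x.1) (hgd x.2)
  · refine ((he N).prod (hd N)).subset ?_
    rintro ⟨a, b⟩ h
    simp only [Set.mem_prod, Set.mem_ofPred_eq] at h ⊢
    omega

theorem hasSum_expand {R ι : Type*} [CommRing R] [TopologicalSpace R] {f : ι → R⟦X⟧} {g : R⟦X⟧}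
    (h : HasSum f g) {q : ℕ} (hq : q ≠ 0) :
    HasSum (fun i => expand q hq (f i)) (expand q hq g) := by
  rw [WithPiTopology.hasSum_iff_hasSum_coeff] at h ⊢
  intro n
  simp only [coeff_expand]
  split_ifs
  · exact h _
  · exact hasSum_zero

theorem exponentsInClass_of_hasSum {R ι : Type*} [CommRing R] [TopologicalSpace R] [T2Space R]
    {f : ι → R⟦X⟧} {g : R⟦X⟧} (h : HasSum f g) {c : ZMod 3}
    (hf : ∀ i, ExponentsInClass c (f i)) : ExponentsInClass c g := by
  intro n hn
  have := (WithPiTopology.hasSum_iff_hasSum_coeff (R := R)).1 h n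
  simp only [hf _ n hn] at this
  exact this.unique hasSum_zero

/-! ### Dissected theta series -/

/-- The triangular number `t (t + 1) / 2`, for an arbitrary integer `t`. -/
def triangular (t : ℤ) : ℕ := (t * (t + 1) / 2).toNat

theorem two_mul_triangular (t : ℤ) : 2 * (triangular t : ℤ) = t * (t + 1) := by
  have h : Even (t * (t + 1)) := Int.even_mul_succ_self t
  have h0 : 0 ≤ t * (t + 1) := by
    rcases le_or_gt 0 t with h | h
    · positivity
    · exact mul_nonneg_of_nonpos_of_nonpos h.le h
  rw [triangular, Int.toNat_of_nonneg (Int.ediv_nonneg h0 two_pos.le)]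
  exact Int.two_mul_ediv_two_of_even h

/-- The term `X ^ (t (t + 1) / 2)` if `t ≡ i` modulo 3, and `0` otherwise. -/
noncomputable def triangularTerm (i : ZMod 3) (t : ℤ) : (ZMod 3)⟦X⟧ :=
  if (t : ZMod 3) = i then X ^ triangular t else 0

/-- The term `(-1) ^ v * X ^ (v ^ 2)` if `v ≡ i` modulo 3, and `0` otherwise. -/
noncomputable def squareTerm (i : ZMod 3) (v : ℤ) : (ZMod 3)⟦X⟧ :=
  if (v : ZMod 3) = i then (v.negOnePow : (ZMod 3)⟦X⟧) * X ^ (v.natAbs ^ 2) else 0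

/-- The series `∑ X ^ (t (t + 1) / 2)` over the integers `t ≡ i` modulo 3. -/
noncomputable def triangularTheta (i : ZMod 3) : (ZMod 3)⟦X⟧ := ∑' t, triangularTerm i t

/-- The series `∑ (-1) ^ v * X ^ (v ^ 2)` over the integers `v ≡ i` modulo 3. -/
noncomputable def squareTheta (i : ZMod 3) : (ZMod 3)⟦X⟧ := ∑' v, squareTerm i v

theorem natAbs_le_triangular_add_one (t : ℤ) : t.natAbs ≤ triangular t + 1 := by
  have h := two_mul_triangular t
  zify
  rcases le_or_gt 0 t with h0 | h0
  · rw [abs_of_nonneg h0]; nlinarith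
  · rw [abs_of_neg h0]; nlinarith

theorem finite_setOf_natAbs_le (N : ℕ) : {v : ℤ | v.natAbs ≤ N}.Finite :=
  (Set.finite_Icc (-(N : ℤ)) N).subset fun v hv => by
    simp only [Set.mem_ofPred_eq] at hv
    rw [Set.mem_Icc]
    omega

theorem X_pow_dvd_triangularTerm (i : ZMod 3) (t : ℤ) :
    X ^ triangular t ∣ triangularTerm i t := by
  unfold triangularTerm
  split_ifs <;> simp

theorem X_pow_dvd_squareTerm (i : ZMod 3) (v : ℤ) : X ^ (v.natAbs ^ 2) ∣ squareTerm i v := by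
  unfold squareTerm
  split_ifs <;> simp

theorem finite_setOf_triangular_le (N : ℕ) : {t : ℤ | triangular t ≤ N}.Finite :=
  (finite_setOf_natAbs_le (N + 1)).subset fun t ht =>
    (natAbs_le_triangular_add_one t).trans (Nat.succ_le_succ ht)

theorem finite_setOf_natAbs_sq_le (N : ℕ) : {v : ℤ | v.natAbs ^ 2 ≤ N}.Finite :=
  (finite_setOf_natAbs_le N).subset fun v hv => (Nat.le_self_pow two_ne_zero v.natAbs).trans hv

theorem hasSum_triangularTheta (i : ZMod 3) : HasSum (triangularTerm i) (triangularTheta i) :=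
  (summable_of_X_pow_dvd triangular (X_pow_dvd_triangularTerm i)
    finite_setOf_triangular_le).hasSum

theorem hasSum_squareTheta (i : ZMod 3) : HasSum (squareTerm i) (squareTheta i) :=
  (summable_of_X_pow_dvd (fun v : ℤ => v.natAbs ^ 2) (X_pow_dvd_squareTerm i)
    finite_setOf_natAbs_sq_le).hasSum

theorem hasSum_triangularTheta_mul_squareTheta (i j : ZMod 3) :
    HasSum (fun x : ℤ × ℤ => triangularTerm i x.1 * squareTerm j x.2)
      (triangularTheta i * squareTheta j) :=
  hasSum_mul_of_X_pow_dvd (hasSum_triangularTheta i) (hasSum_squareTheta j) triangular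
    (fun v : ℤ => v.natAbs ^ 2) (X_pow_dvd_triangularTerm i) (X_pow_dvd_squareTerm j)
    finite_setOf_triangular_le finite_setOf_natAbs_sq_le

theorem exponentsInClass_X_pow {n : ℕ} {c : ZMod 3} (h : (n : ZMod 3) = c) :
    ExponentsInClass c (X ^ n : (ZMod 3)⟦X⟧) := by
  intro m hm
  rw [coeff_X_pow, if_neg]
  rintro rfl
  exact hm h

theorem intCast_negOnePow_eq_C (v : ℤ) :
    (v.negOnePow : (ZMod 3)⟦X⟧) = C (v.negOnePow : ZMod 3) := by
  simp

theorem exponentsInClass_triangularTheta (i : ZMod 3) :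
    ExponentsInClass (2 * (i * (i + 1))) (triangularTheta i) := by
  refine exponentsInClass_of_hasSum (hasSum_triangularTheta i) fun t => ?_
  unfold triangularTerm
  split_ifs with h
  · refine exponentsInClass_X_pow ?_
    have h2 := congrArg (Int.cast : ℤ → ZMod 3) (two_mul_triangular t)
    push_cast at h2
    rw [h] at h2
    rw [← h2, ← mul_assoc, show (2 * 2 : ZMod 3) = 1 from rfl, one_mul]
  · intro n _
    simp

theorem exponentsInClass_squareTheta (i : ZMod 3) :
    ExponentsInClass (i ^ 2) (squareTheta i) := by
  refine exponentsInClass_of_hasSum (hasSum_squareTheta i) fun v => ?_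
  unfold squareTerm
  split_ifs with h
  · intro n hn
    rw [intCast_negOnePow_eq_C, coeff_C_mul, exponentsInClass_X_pow ?_ n hn, mul_zero]
    have h2 := congrArg (Int.cast : ℤ → ZMod 3) (Int.natAbs_sq v)
    simp only [Int.cast_pow, Int.cast_natCast] at h2
    rw [Nat.cast_pow, h2, h]
  · intro n _
    simp

theorem triangularTheta_two : triangularTheta 2 = triangularTheta 0 := by
  refine ((hasSum_triangularTheta 2).unique ?_)
  have h := (Equiv.subLeft (-1 : ℤ)).hasSum_iff.2 (hasSum_triangularTheta 0)
  convert h using 1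
  funext t
  have h1 : triangular (-1 - t) = triangular t := by
    have := two_mul_triangular (-1 - t)
    have := two_mul_triangular t
    zify
    linarith
  have h2 : ((-1 - t : ℤ) : ZMod 3) = 0 ↔ (t : ZMod 3) = 2 := by
    push_cast
    generalize (t : ZMod 3) = x
    revert x
    decide
  simp only [Function.comp_apply, Equiv.subLeft_apply, triangularTerm, h1, h2]

theorem squareTheta_two : squareTheta 2 = squareTheta 1 := by
  refine ((hasSum_squareTheta 2).unique ?_)
  have h := (Equiv.neg ℤ).hasSum_iff.2 (hasSum_squareTheta 1)
  convert h using 1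
  funext v
  have h2 : ((-v : ℤ) : ZMod 3) = 1 ↔ (v : ZMod 3) = 2 := by
    push_cast
    generalize (v : ZMod 3) = x
    revert x
    decide
  simp only [Function.comp_apply, Equiv.neg_apply, squareTerm, h2, Int.natAbs_neg,
    Int.negOnePow_neg]

theorem sum_ite_zmod_three {M : Type*} [AddCommMonoid M] (x : ZMod 3) (a : M) :
    (if x = 0 then a else 0) + (if x = 1 then a else 0) + (if x = 2 then a else 0) = a := by
  obtain rfl | rfl | rfl : x = 0 ∨ x = 1 ∨ x = 2 := by
    revert x
    decide
  · rw [if_pos rfl, if_neg (by decide), if_neg (by decide), add_zero, add_zero]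
  · rw [if_neg (by decide), if_pos rfl, if_neg (by decide), zero_add, add_zero]
  · rw [if_neg (by decide), if_neg (by decide), if_pos rfl, zero_add, zero_add]

/-- The integers `v = 3 w` contribute a copy of the whole series with `X` replaced by `X ^ 9`. -/
theorem squareTheta_zero :
    squareTheta 0 = expand 9 (by norm_num) (squareTheta 0 + squareTheta 1 + squareTheta 2) := by
  have h := hasSum_expand (((hasSum_squareTheta 0).add (hasSum_squareTheta 1)).add
    (hasSum_squareTheta 2)) (q := 9) (by norm_num)
  have hinj : Function.Injective (fun v : ℤ => 3 * v) := fun a b hab => by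
    simp only at hab
    omega
  refine (hinj.hasSum_iff ?_).2 (hasSum_squareTheta 0) |>.unique ?_
  · intro v hv
    rw [squareTerm, if_neg]
    intro h0
    obtain ⟨w, rfl⟩ := (ZMod.intCast_zmod_eq_zero_iff_dvd v 3).1 h0
    exact hv ⟨w, rfl⟩
  · convert h using 1
    funext v
    have h3 : squareTerm 0 v + squareTerm 1 v + squareTerm 2 v
        = (v.negOnePow : (ZMod 3)⟦X⟧) * X ^ (v.natAbs ^ 2) := by
      exact sum_ite_zmod_three _ _
    have h4 : ((3 * v : ℤ) : ZMod 3) = 0 := by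
      push_cast
      rw [show (3 : ZMod 3) = 0 from rfl, zero_mul]
    rw [h3, Function.comp_apply, squareTerm, if_pos h4, map_mul, map_pow, expand_X,
      intCast_negOnePow_eq_C, intCast_negOnePow_eq_C, expand_C, ← pow_mul, Int.natAbs_mul]
    congr 2
    · rw [show 3 * v = v + 2 * v by ring, Int.negOnePow_add, Int.negOnePow_even (2 * v) (by simp),
        mul_one]
    · rw [mul_pow]
      rfl

/-- The integers `t = 3 w + 1` contribute `X` times a copy of the whole series with `X` replaced
by `X ^ 9`, because `T (3 w + 1) = 9 T w + 1` for the triangular numbers `T`. -/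
theorem triangularTheta_one :
    triangularTheta 1 = X *
      expand 9 (by norm_num) (triangularTheta 0 + triangularTheta 1 + triangularTheta 2) := by
  have h := (hasSum_expand (((hasSum_triangularTheta 0).add (hasSum_triangularTheta 1)).add
    (hasSum_triangularTheta 2)) (q := 9) (by norm_num)).mul_left X
  have hinj : Function.Injective (fun t : ℤ => 3 * t + 1) := fun a b hab => by
    simp only at hab
    omega
  refine (hinj.hasSum_iff ?_).2 (hasSum_triangularTheta 1) |>.unique ?_
  · intro t ht
    rw [triangularTerm, if_neg]
    intro h0
    obtain ⟨w, hw⟩ := (ZMod.intCast_zmod_eq_zero_iff_dvd (t - 1) 3).1 (by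
      push_cast
      rw [h0, sub_self])
    exact ht ⟨w, by push_cast at hw; simp only; omega⟩
  · suffices hterm : ∀ t, triangularTerm 1 (3 * t + 1) = X * expand 9 (by norm_num)
        (triangularTerm 0 t + triangularTerm 1 t + triangularTerm 2 t) by
      exact (funext hterm : triangularTerm 1 ∘ (fun t : ℤ => 3 * t + 1) = _) ▸ h
    intro t
    have h3 : triangularTerm 0 t + triangularTerm 1 t + triangularTerm 2 t = X ^ triangular t := by
      exact sum_ite_zmod_three _ _
    have h4 : ((3 * t + 1 : ℤ) : ZMod 3) = 1 := by
      push_cast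
      rw [show (3 : ZMod 3) = 0 from rfl, zero_mul, zero_add]
    have h5 : triangular (3 * t + 1) = 9 * triangular t + 1 := by
      have := two_mul_triangular (3 * t + 1)
      have := two_mul_triangular t
      zify
      linarith
    rw [h3, triangularTerm, if_pos h4, h5, map_pow, expand_X, ← pow_mul,
      pow_succ, mul_comm]

/-! ### The binary theta series `∑ (-1) ^ v X ^ (t (t + 1) / 2 + v ^ 2)` by residue classes -/

/-- The term `(-1) ^ v * X ^ (t (t + 1) / 2 + v ^ 2)` if `t + v ≡ c` modulo 3, and `0` otherwise. -/
noncomputable def binaryTerm (c : ZMod 3) (x : ℤ × ℤ) : (ZMod 3)⟦X⟧ :=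
  if ((x.1 + x.2 : ℤ) : ZMod 3) = c then
    (x.2.negOnePow : (ZMod 3)⟦X⟧) * X ^ (triangular x.1 + x.2.natAbs ^ 2) else 0

/-- The sum of `binaryTerm c` over `ℤ × ℤ`, written through the dissected theta series. -/
noncomputable def binaryTheta (c : ZMod 3) : (ZMod 3)⟦X⟧ :=
  triangularTheta 0 * squareTheta c + triangularTheta 1 * squareTheta (c - 1) +
    triangularTheta 2 * squareTheta (c - 2)

theorem hasSum_binaryTheta (c : ZMod 3) : HasSum (binaryTerm c) (binaryTheta c) := by
  have h := ((hasSum_triangularTheta_mul_squareTheta 0 c).add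
    (hasSum_triangularTheta_mul_squareTheta 1 (c - 1))).add
    (hasSum_triangularTheta_mul_squareTheta 2 (c - 2))
  suffices hterm : ∀ x : ℤ × ℤ, binaryTerm c x =
      triangularTerm 0 x.1 * squareTerm c x.2 + triangularTerm 1 x.1 * squareTerm (c - 1) x.2 +
        triangularTerm 2 x.1 * squareTerm (c - 2) x.2 by
    exact (funext hterm : binaryTerm c = _) ▸ h
  rintro ⟨t, v⟩
  -- Split the term according to the class of `t`.
  rw [← sum_ite_zmod_three (t : ZMod 3) (binaryTerm c (t, v))]
  have hterm (i : ZMod 3) : (if (t : ZMod 3) = i then binaryTerm c (t, v) else 0) =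
      triangularTerm i t * squareTerm (c - i) v := by
    unfold binaryTerm triangularTerm squareTerm
    by_cases h1 : (t : ZMod 3) = i
    · rw [if_pos h1, if_pos h1]
      have h2 : ((t + v : ℤ) : ZMod 3) = c ↔ (v : ZMod 3) = c - i := by
        rw [Int.cast_add, h1, eq_sub_iff_add_eq, add_comm]
      simp only [h2]
      split_ifs
      · ring
      · rw [mul_zero]
    · rw [if_neg h1, if_neg h1, zero_mul]
  rw [hterm, hterm, hterm, sub_zero]

/-- The involution `(1 - v + 3 k, v) ↦ (v + k, 1 - v + 2 k)` of the pairs `(t, v)` with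
`t + v ≡ 1` modulo 3. In the coordinates `w = (2 t + 1 - v) / 3` and `v`, for which
`8 (t (t + 1) / 2 + v ^ 2) + 1 = 9 w ^ 2 + 6 w v + 9 v ^ 2`, it exchanges `w` and `v`. -/
def swapPair (x : ℤ × ℤ) : ℤ × ℤ :=
  if (x.1 + x.2) % 3 = 1 then ((x.1 + 4 * x.2 - 1) / 3, (2 * x.1 + 1 - x.2) / 3) else x

theorem swapPair_of_param (v k : ℤ) : swapPair (1 - v + 3 * k, v) = (v + k, 1 - v + 2 * k) := by
  unfold swapPair
  rw [if_pos (by simp only; omega)]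
  ext <;> simp only <;> omega

theorem swapPair_involutive : Function.Involutive swapPair := by
  rintro ⟨t, v⟩
  by_cases h : (t + v) % 3 = 1
  · obtain ⟨k, rfl⟩ : ∃ k, t = 1 - v + 3 * k := ⟨(t + v) / 3, by omega⟩
    rw [swapPair_of_param, show v + k = 1 - (1 - v + 2 * k) + 3 * k by ring, swapPair_of_param]
    ext <;> simp only <;> ring
  · have : swapPair (t, v) = (t, v) := if_neg h
    rw [this, this]

theorem binaryTerm_swapPair (x : ℤ × ℤ) : binaryTerm 1 (swapPair x) = -binaryTerm 1 x := by
  obtain ⟨t, v⟩ := x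
  by_cases h : (t + v) % 3 = 1
  · obtain ⟨k, rfl⟩ : ∃ k, t = 1 - v + 3 * k := ⟨(t + v) / 3, by omega⟩
    have hclass (z : ℤ) (hz : z = 1 + 3 * k) : (z : ZMod 3) = 1 := by
      rw [hz]
      push_cast
      rw [show (3 : ZMod 3) = 0 from rfl, zero_mul, add_zero]
    have hexp : triangular (v + k) + (1 - v + 2 * k).natAbs ^ 2 =
        triangular (1 - v + 3 * k) + v.natAbs ^ 2 := by
      have h1 := two_mul_triangular (v + k)
      have h2 := two_mul_triangular (1 - v + 3 * k)
      zify
      rw [sq_abs, sq_abs]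
      linarith
    rw [swapPair_of_param, binaryTerm, binaryTerm, if_pos (hclass _ (by ring)),
      if_pos (hclass _ (by ring))]
    simp only
    rw [hexp, show 1 - v + 2 * k = 1 + (2 * (k - v) + v) by ring, Int.negOnePow_add,
      Int.negOnePow_add, Int.negOnePow_even (2 * (k - v)) (by simp), Int.negOnePow_one]
    simp
  · have h0 : binaryTerm 1 (t, v) = 0 := by
      refine if_neg fun hc => h ?_
      have := (ZMod.intCast_eq_intCast_iff' (t + v) 1 3).1 (by simpa using hc)
      simpa using this
    have : swapPair (t, v) = (t, v) := if_neg h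
    rw [this, h0, neg_zero]

/-- The involution `swapPair` cancels the terms with `t + v ≡ 1` modulo 3 in pairs. -/
theorem binaryTheta_one : binaryTheta 1 = 0 := by
  have h := hasSum_binaryTheta 1
  have h1 := (swapPair_involutive.toPerm.hasSum_iff (f := binaryTerm 1)).2 h
  have h2 : binaryTheta 1 = -binaryTheta 1 :=
    ((funext binaryTerm_swapPair : binaryTerm 1 ∘ swapPair = fun x => -binaryTerm 1 x) ▸ h1).unique
      h.neg
  ext n
  have h3 := congrArg (coeff n) h2
  rw [map_neg] at h3
  rw [map_zero]
  revert h3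
  generalize coeff n (binaryTheta 1) = x
  revert x
  decide

/-- The series `∏ (1 - X ^ n) * ∏ (1 - X ^ (2 n))`, where each product is written as the
pentagonal number series. -/
noncomputable def eulerProduct : (ZMod 3)⟦X⟧ :=
  pentagonalSeries (ZMod 3) * expand 2 two_ne_zero (pentagonalSeries (ZMod 3))

theorem finite_setOf_pentagonal_le (N : ℕ) : {k : ℤ | pentagonal k ≤ N}.Finite := by
  refine Set.Finite.of_finite_image ((Set.finite_Iic N).subset ?_) pentagonal_injective.injOn
  rintro _ ⟨k, hk, rfl⟩
  exact hk

theorem finite_setOf_two_mul_pentagonal_le (N : ℕ) : {k : ℤ | 2 * pentagonal k ≤ N}.Finite :=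
  (finite_setOf_pentagonal_le N).subset fun k (hk : 2 * pentagonal k ≤ N) =>
    (Nat.le_mul_of_pos_left _ two_pos).trans hk

theorem hasSum_expand_two_pentagonalSeries (R : Type*) [CommRing R] [TopologicalSpace R] :
    HasSum (fun b : ℤ => (b.negOnePow : R⟦X⟧) * X ^ (2 * pentagonal b))
      (expand 2 two_ne_zero (pentagonalSeries R)) := by
  convert hasSum_expand (WithPiTopology.hasSum_pentagonalSeries R) two_ne_zero using 2 with b
  rw [map_mul, map_pow, expand_X, ← pow_mul, map_intCast]

theorem hasSum_pentagonalSeries_mul_expand (R : Type*) [CommRing R] [TopologicalSpace R]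
    [IsTopologicalRing R] [T3Space R] :
    HasSum (fun x : ℤ × ℤ => ((x.1.negOnePow : R⟦X⟧) * X ^ pentagonal x.1) *
      ((x.2.negOnePow : R⟦X⟧) * X ^ (2 * pentagonal x.2)))
      (pentagonalSeries R * expand 2 two_ne_zero (pentagonalSeries R)) := by
  have h := hasSum_mul_of_X_pow_dvd (WithPiTopology.hasSum_pentagonalSeries R)
    (hasSum_expand_two_pentagonalSeries R) pentagonal (fun b => 2 * pentagonal b)
    (fun _ => dvd_mul_left _ _) (fun _ => dvd_mul_left _ _)
  exact h finite_setOf_pentagonal_le finite_setOf_two_mul_pentagonal_le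

/-- Both sides are double sums of signed powers of `X`, and the linear substitution
`(t, v) = (-a - 2 b, a - b)`, which maps `ℤ × ℤ` onto the pairs with `3 ∣ t + v`, carries the
product of the two pentagonal sums to the binary theta series. -/
theorem binaryTheta_zero : binaryTheta 0 = eulerProduct := by
  have hinj : Function.Injective (fun x : ℤ × ℤ => (-x.1 - 2 * x.2, x.1 - x.2)) := by
    rintro ⟨a, b⟩ ⟨c, d⟩ h
    simp only [Prod.mk.injEq] at h ⊢
    omega
  refine (hinj.hasSum_iff ?_).2 (hasSum_binaryTheta 0) |>.unique ?_
  · rintro ⟨t, v⟩ h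
    refine if_neg fun hc => h ?_
    obtain ⟨w, hw⟩ := (ZMod.intCast_zmod_eq_zero_iff_dvd _ 3).1 hc
    refine ⟨(v - w, -w), ?_⟩
    simp only [Prod.mk.injEq]
    push_cast at hw
    omega
  · suffices hterm : ∀ x : ℤ × ℤ, binaryTerm 0 (-x.1 - 2 * x.2, x.1 - x.2) =
        ((x.1.negOnePow : (ZMod 3)⟦X⟧) * X ^ pentagonal x.1) *
          ((x.2.negOnePow : (ZMod 3)⟦X⟧) * X ^ (2 * pentagonal x.2)) by
      exact (funext hterm : binaryTerm 0 ∘ (fun x : ℤ × ℤ => (-x.1 - 2 * x.2, x.1 - x.2)) = _) ▸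
        hasSum_pentagonalSeries_mul_expand (ZMod 3)
    rintro ⟨a, b⟩
    have hclass : ((-a - 2 * b + (a - b) : ℤ) : ZMod 3) = 0 := by
      rw [show -a - 2 * b + (a - b) = 3 * -b by ring]
      push_cast
      rw [show (3 : ZMod 3) = 0 from rfl, zero_mul]
    have hexp : triangular (-a - 2 * b) + (a - b).natAbs ^ 2 =
        pentagonal a + 2 * pentagonal b := by
      have h1 := two_mul_triangular (-a - 2 * b)
      have h2 := two_mul_natCast_pentagonal a
      have h3 := two_mul_natCast_pentagonal b
      zify
      rw [sq_abs]
      linarith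
    rw [binaryTerm, if_pos hclass]
    simp only
    rw [hexp, Int.negOnePow_sub, pow_add]
    push_cast
    ring

/-! ### The 3-dissection of the product modulo 3 -/

theorem three_eq_zero_powerSeries : (3 : (ZMod 3)⟦X⟧) = 0 := by
  rw [← map_ofNat (C (R := ZMod 3)) 3, show (OfNat.ofNat 3 : ZMod 3) = 0 from rfl, map_zero]

/-- In characteristic 3 the vanishing of `binaryTheta 1` says that the two products of theta
series with exponents in the class 1 agree. -/
theorem triangularTheta_zero_mul_squareTheta_one :
    triangularTheta 0 * squareTheta 1 = triangularTheta 1 * squareTheta 0 := by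
  have h := binaryTheta_one
  rw [binaryTheta, show (1 - 1 : ZMod 3) = 0 from rfl, show (1 - 2 : ZMod 3) = 2 from rfl,
    squareTheta_two, triangularTheta_two] at h
  linear_combination -h + triangularTheta 0 * squareTheta 1 * three_eq_zero_powerSeries

theorem eulerProduct_eq_sum :
    eulerProduct = triangularTheta 0 * squareTheta 0 + triangularTheta 1 * squareTheta 0 +
      triangularTheta 1 * squareTheta 1 := by
  rw [← triangularTheta_zero_mul_squareTheta_one, ← binaryTheta_zero, binaryTheta,
    show (0 - 1 : ZMod 3) = 2 from rfl, show (0 - 2 : ZMod 3) = 1 from rfl,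
    squareTheta_two, triangularTheta_two]
  ring

theorem theta_mul_theta :
    (triangularTheta 0 + triangularTheta 1 + triangularTheta 2) *
      (squareTheta 0 + squareTheta 1 + squareTheta 2) = -eulerProduct := by
  rw [eulerProduct_eq_sum, squareTheta_two, triangularTheta_two]
  linear_combination triangularTheta_zero_mul_squareTheta_one +
    (triangularTheta 0 * squareTheta 0 + triangularTheta 1 * squareTheta 0 +
      triangularTheta 1 * squareTheta 1 + triangularTheta 0 * squareTheta 1) *
      three_eq_zero_powerSeries

theorem triangularTheta_one_mul_squareTheta_zero :
    triangularTheta 1 * squareTheta 0 = -(X * expand 9 (by norm_num) eulerProduct) := by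
  rw [triangularTheta_one, squareTheta_zero, mul_assoc, ← map_mul,
    theta_mul_theta, map_neg, mul_neg]

theorem exponentsInClass_triangular_zero_mul_square_zero :
    ExponentsInClass 0 (triangularTheta 0 * squareTheta 0) :=
  (exponentsInClass_triangularTheta 0).mul (exponentsInClass_squareTheta 0)

theorem exponentsInClass_triangular_one_mul_square_zero :
    ExponentsInClass 1 (triangularTheta 1 * squareTheta 0) :=
  (exponentsInClass_triangularTheta 1).mul (exponentsInClass_squareTheta 0)

theorem exponentsInClass_triangular_one_mul_square_one :
    ExponentsInClass 2 (triangularTheta 1 * squareTheta 1) :=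
  (exponentsInClass_triangularTheta 1).mul (exponentsInClass_squareTheta 1)

theorem seriesSection_one_eulerProduct :
    seriesSection 3 1 eulerProduct = -expand 3 (by norm_num) eulerProduct := by
  have h1 : seriesSection 3 1 eulerProduct =
      seriesSection 3 1 (triangularTheta 1 * squareTheta 0) := by
    rw [eulerProduct_eq_sum, seriesSection_add, seriesSection_add,
      exponentsInClass_triangular_zero_mul_square_zero.seriesSection_eq_zero (by decide),
      exponentsInClass_triangular_one_mul_square_one.seriesSection_eq_zero (by decide), zero_add,
      add_zero]
  have h2 : expand 9 (by norm_num) eulerProduct =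
      expand 3 (by norm_num) (expand 3 (by norm_num) eulerProduct) :=
    PowerSeries.expand_mul 3 (by norm_num) 3 (by norm_num) eulerProduct
  rw [h1, triangularTheta_one_mul_squareTheta_zero]
  ext n
  rw [coeff_seriesSection, map_neg, map_neg, coeff_succ_X_mul, h2, coeff_expand_mul]

/-- In the square of `A + P + B`, with exponents in the classes 0, 1, 2, the part in the class 2 is
`P ^ 2 + 2 A B`. It equals `3 P ^ 2` because `A B = P ^ 2`. -/
theorem seriesSection_two_eulerProduct_sq : seriesSection 3 2 (eulerProduct ^ 2) = 0 := by
  have h : eulerProduct ^ 2 =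
      (triangularTheta 0 * squareTheta 0) * (triangularTheta 0 * squareTheta 0) +
      (triangularTheta 1 * squareTheta 1) * (triangularTheta 1 * squareTheta 0) +
      (triangularTheta 1 * squareTheta 1) * (triangularTheta 1 * squareTheta 0) +
      (triangularTheta 1 * squareTheta 1) * (triangularTheta 1 * squareTheta 1) +
      (triangularTheta 0 * squareTheta 0) * (triangularTheta 1 * squareTheta 0) +
      (triangularTheta 0 * squareTheta 0) * (triangularTheta 1 * squareTheta 0) := by
    rw [eulerProduct_eq_sum]
    linear_combination
      triangularTheta 0 * squareTheta 0 * triangularTheta 1 * squareTheta 1 *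
        three_eq_zero_powerSeries -
      triangularTheta 1 * squareTheta 0 * triangularTheta_zero_mul_squareTheta_one
  have h0 := exponentsInClass_triangular_zero_mul_square_zero
  have h1 := exponentsInClass_triangular_one_mul_square_zero
  have h2 := exponentsInClass_triangular_one_mul_square_one
  rw [h]
  simp only [seriesSection_add]
  rw [(h0.mul h0).seriesSection_eq_zero (by decide), (h2.mul h1).seriesSection_eq_zero (by decide),
    (h2.mul h2).seriesSection_eq_zero (by decide), (h0.mul h1).seriesSection_eq_zero (by decide)]
  simp only [add_zero]

/-- The coefficients of the seventh power of the product at the exponents `9 n + 7` vanish. -/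
theorem seriesSection_eulerProduct_pow_seven : seriesSection 9 7 (eulerProduct ^ 7) = 0 := by
  have h1 : eulerProduct ^ 7 = eulerProduct * expand 3 (by norm_num) (eulerProduct ^ 2) := by
    rw [← pow_three_eq_expand]
    ring
  have h2 : seriesSection 3 1 (eulerProduct ^ 7) =
      eulerProduct ^ 2 * expand 3 (by norm_num) (-eulerProduct) := by
    rw [h1, seriesSection_mul_expand (by norm_num), seriesSection_one_eulerProduct, map_neg]
    ring
  have h3 : seriesSection 3 2 (seriesSection 3 1 (eulerProduct ^ 7)) = 0 := by
    rw [h2, seriesSection_mul_expand (by norm_num), seriesSection_two_eulerProduct_sq, zero_mul]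
  ext n
  rw [← h3, coeff_seriesSection, coeff_seriesSection, coeff_seriesSection]
  congr 1
  congr 1
  ring

/-! ### The generating function of colored partitions -/

/-- The partitions of `n` all of whose colored parts lie in `S`. -/
def partitionsFrom (S : Finset (ℕ × ℕ)) (n : ℕ) : Set (Multiset (ℕ × ℕ)) :=
  {M | (∀ x ∈ M, x ∈ S) ∧ (M.map Prod.fst).sum = n}

theorem partitionsFrom_finite {r s : ℕ} {S : Finset (ℕ × ℕ)}
    (hS : ∀ x ∈ S, 0 < x.1 ∧ x.2 < numColors r s x.1) (n : ℕ) : (partitionsFrom S n).Finite :=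
  (coloredPartitions_finite r s n).subset fun _ hM => ⟨fun x hx => hS x (hM.1 x hx), hM.2⟩

/-- A partition with parts in `insert p S` either avoids `p` or contains a copy of `p`, which can
be removed. -/
theorem partitionsFrom_insert (p : ℕ × ℕ) (S : Finset (ℕ × ℕ)) (n : ℕ) :
    partitionsFrom (insert p S) (n + p.1) =
      partitionsFrom S (n + p.1) ∪ (p ::ₘ ·) '' partitionsFrom (insert p S) n := by
  ext M
  constructor
  · rintro ⟨h1, h2⟩
    by_cases hp : p ∈ M
    · right
      obtain ⟨M', rfl⟩ := Multiset.exists_cons_of_mem hp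
      refine ⟨M', ⟨fun x hx => h1 x (Multiset.mem_cons_of_mem hx), ?_⟩, rfl⟩
      rw [Multiset.map_cons, Multiset.sum_cons] at h2
      omega
    · left
      refine ⟨fun x hx => ?_, h2⟩
      rcases Finset.mem_insert.1 (h1 x hx) with rfl | h
      · exact absurd hx hp
      · exact h
  · rintro (⟨h1, h2⟩ | ⟨M', ⟨h1, h2⟩, rfl⟩)
    · exact ⟨fun x hx => Finset.mem_insert_of_mem (h1 x hx), h2⟩
    · refine ⟨fun x hx => ?_, ?_⟩
      · rcases Multiset.mem_cons.1 hx with rfl | h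
        · exact Finset.mem_insert_self _ _
        · exact h1 x h
      · simp only [Multiset.map_cons, Multiset.sum_cons, h2]
        omega

theorem ncard_partitionsFrom_insert {r s : ℕ} {p : ℕ × ℕ} {S : Finset (ℕ × ℕ)} (hp : p ∉ S)
    (hS : ∀ x ∈ insert p S, 0 < x.1 ∧ x.2 < numColors r s x.1) (n : ℕ) :
    (partitionsFrom (insert p S) (n + p.1)).ncard =
      (partitionsFrom S (n + p.1)).ncard + (partitionsFrom (insert p S) n).ncard := by
  have hfin := partitionsFrom_finite hS n
  rw [partitionsFrom_insert, Set.ncard_union_eq ?_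
    (partitionsFrom_finite (fun x hx => hS x (Finset.mem_insert_of_mem hx)) _) (hfin.image _),
    Set.ncard_image_of_injective _ fun _ _ h => (Multiset.cons_inj_right p).1 h]
  rw [Set.disjoint_left]
  rintro _ ⟨h1, -⟩ ⟨M, -, rfl⟩
  exact hp (h1 p (Multiset.mem_cons_self p M))

theorem partitionsFrom_insert_of_lt {p : ℕ × ℕ} {S : Finset (ℕ × ℕ)} {n : ℕ} (hn : n < p.1) :
    partitionsFrom (insert p S) n = partitionsFrom S n := by
  ext M
  refine ⟨fun ⟨h1, h2⟩ => ⟨fun x hx => ?_, h2⟩,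
    fun ⟨h1, h2⟩ => ⟨fun x hx => Finset.mem_insert_of_mem (h1 x hx), h2⟩⟩
  rcases Finset.mem_insert.1 (h1 x hx) with rfl | h
  · have := Multiset.le_sum_of_mem (Multiset.mem_map_of_mem Prod.fst hx)
    omega
  · exact h

theorem partitionsFrom_empty (n : ℕ) :
    partitionsFrom ∅ n = if n = 0 then {0} else ∅ := by
  ext M
  constructor
  · rintro ⟨h1, h2⟩
    have hM : M = 0 := Multiset.eq_zero_of_forall_notMem fun x hx => by simpa using h1 x hx
    subst hM
    rw [if_pos (by simpa using h2.symm)]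
    rfl
  · split_ifs with h
    · rintro rfl
      exact ⟨by simp, by simp [h]⟩
    · exact fun h => h.elim

theorem mk_ncard_partitionsFrom_mul_prod (R : Type*) [CommRing R] {r s : ℕ}
    (S : Finset (ℕ × ℕ)) (hS : ∀ x ∈ S, 0 < x.1 ∧ x.2 < numColors r s x.1) :
    (PowerSeries.mk fun n => ((partitionsFrom S n).ncard : R)) * ∏ x ∈ S, (1 - X ^ x.1) = 1 := by
  induction S using Finset.induction_on with
  | empty =>
    ext n
    rw [Finset.prod_empty, mul_one, coeff_mk, partitionsFrom_empty, coeff_one]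
    split_ifs <;> simp
  | insert p S hp ih =>
    rw [Finset.prod_insert hp, ← mul_assoc]
    refine Eq.trans ?_ (ih fun x hx => hS x (Finset.mem_insert_of_mem hx))
    congr 1
    ext n
    rw [mul_sub, mul_one, map_sub, coeff_mk, coeff_mk, coeff_mul_X_pow']
    split_ifs with h
    · obtain ⟨m, rfl⟩ := Nat.exists_eq_add_of_le' h
      rw [coeff_mk, ncard_partitionsFrom_insert hp hS, Nat.add_sub_cancel, Nat.cast_add,
        add_sub_cancel_right]
    · rw [partitionsFrom_insert_of_lt (not_le.1 h), sub_zero]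

/-- The available colored parts of size at most `N`. -/
def coloredPartsUpTo (r s N : ℕ) : Finset (ℕ × ℕ) :=
  (Finset.Icc 1 N ×ˢ Finset.range (r + s)).filter fun x => x.2 < numColors r s x.1

theorem mem_coloredPartsUpTo {r s N : ℕ} {x : ℕ × ℕ} :
    x ∈ coloredPartsUpTo r s N ↔
      x.1 ∈ Finset.Icc 1 N ∧ x.2 ∈ Finset.range (numColors r s x.1) := by
  have : numColors r s x.1 ≤ r + s := by
    unfold numColors
    split_ifs <;> omega
  simp only [coloredPartsUpTo, Finset.mem_filter, Finset.mem_product, Finset.mem_Icc,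
    Finset.mem_range]
  omega

theorem partitionsFrom_coloredPartsUpTo {r s n N : ℕ} (h : n ≤ N) :
    partitionsFrom (coloredPartsUpTo r s N) n = coloredPartitions r s n := by
  ext M
  refine ⟨fun ⟨h1, h2⟩ => ⟨fun x hx => ?_, h2⟩, fun ⟨h1, h2⟩ => ⟨fun x hx => ?_, h2⟩⟩
  · have := mem_coloredPartsUpTo.1 (h1 x hx)
    rw [Finset.mem_Icc, Finset.mem_range] at this
    omega
  · have h3 := Multiset.le_sum_of_mem (Multiset.mem_map_of_mem Prod.fst hx)
    have h4 := h1 x hx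
    rw [mem_coloredPartsUpTo, Finset.mem_Icc, Finset.mem_range]
    omega

/-- The generating function `∑ a_{r,s}(n) X ^ n` with coefficients in `R`. -/
noncomputable def coloredPartitionSeries (R : Type*) [CommRing R] (r s : ℕ) : R⟦X⟧ :=
  PowerSeries.mk fun n => (coloredPartitionCount r s n : R)

theorem prod_Icc_one_eq_prod_range {M : Type*} [CommMonoid M] (f : ℕ → M) (N : ℕ) :
    ∏ m ∈ Finset.Icc 1 N, f m = ∏ i ∈ Finset.range N, f (i + 1) := by
  induction N with
  | zero => simp
  | succ N ih => rw [Finset.prod_Icc_succ_top (by omega), Finset.prod_range_succ, ih]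

theorem coeff_coloredPartitionSeries_mul_prod (R : Type*) [CommRing R] (r s : ℕ) {n N : ℕ}
    (h : n ≤ N) :
    coeff n (coloredPartitionSeries R r s *
      ∏ i ∈ Finset.range N, (1 - X ^ (i + 1)) ^ numColors r s (i + 1)) =
      coeff n (1 : R⟦X⟧) := by
  have h1 := mk_ncard_partitionsFrom_mul_prod R (coloredPartsUpTo r s N) (r := r) (s := s)
    fun x hx => by
      have := mem_coloredPartsUpTo.1 hx
      rw [Finset.mem_Icc, Finset.mem_range] at this
      omega
  rw [Finset.prod_finset_product (coloredPartsUpTo r s N) (Finset.Icc 1 N)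
    (fun m => Finset.range (numColors r s m)) fun x => mem_coloredPartsUpTo] at h1
  simp only [Finset.prod_const, Finset.card_range] at h1
  rw [prod_Icc_one_eq_prod_range (fun m => (1 - X ^ m : R⟦X⟧) ^ numColors r s m)] at h1
  refine Eq.trans ?_ (congrArg (coeff n) h1)
  rw [coeff_mul, coeff_mul]
  refine Finset.sum_congr rfl fun p hp => ?_
  rw [Finset.HasAntidiagonal.mem_antidiagonal] at hp
  rw [coloredPartitionSeries, coeff_mk, coeff_mk, partitionsFrom_coloredPartsUpTo (by omega),
    coloredPartitionCount]

theorem prod_numColors {R : Type*} [CommRing R] (r s M : ℕ) :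
    (∏ i ∈ Finset.range (2 * M), (1 - X ^ (i + 1) : R⟦X⟧) ^ numColors r s (i + 1)) *
      (∏ i ∈ Finset.range M, (1 - X ^ (2 * (i + 1)) : R⟦X⟧)) ^ s =
    (∏ i ∈ Finset.range M, (1 - X ^ (2 * (i + 1)) : R⟦X⟧)) ^ r *
      (∏ i ∈ Finset.range (2 * M), (1 - X ^ (i + 1) : R⟦X⟧)) ^ s := by
  induction M with
  | zero => simp
  | succ M ih =>
    have h1 : numColors r s (2 * M + 1) = s := if_neg (by simp)
    have h2 : numColors r s (2 * M + 1 + 1) = r := if_pos (by simp [Nat.even_add_one])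
    rw [show 2 * (M + 1) = 2 * M + 1 + 1 by ring]
    simp only [Finset.prod_range_succ, h1, h2, mul_pow]
    rw [show 2 * (M + 1) = 2 * M + 1 + 1 by ring]
    linear_combination (1 - X ^ (2 * M + 1) : R⟦X⟧) ^ s * (1 - X ^ (2 * M + 1 + 1)) ^ r *
      (1 - X ^ (2 * M + 1 + 1)) ^ s * ih

/-- The generating function identity
`(∑ a_{r,s}(n) X ^ n) * ∏ (1 - X ^ (2 n)) ^ r * ∏ (1 - X ^ n) ^ s = ∏ (1 - X ^ (2 n)) ^ s`. -/
theorem coloredPartitionSeries_mul (R : Type*) [CommRing R] [TopologicalSpace R]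
    [IsTopologicalRing R] [T2Space R] (r s : ℕ) :
    coloredPartitionSeries R r s * (expand 2 two_ne_zero (pentagonalSeries R) ^ r *
      pentagonalSeries R ^ s) = expand 2 two_ne_zero (pentagonalSeries R) ^ s := by
  have hdouble : Tendsto (fun M : ℕ => 2 * M) atTop atTop :=
    tendsto_atTop_mono (fun M => Nat.le_mul_of_pos_left M two_pos) tendsto_id
  have hE1 := (WithPiTopology.hasProd_one_sub_X_pow R).tendsto_prod_nat
  have hE2 : Tendsto (fun M => ∏ i ∈ Finset.range M, (1 - X ^ (2 * (i + 1)) : R⟦X⟧)) atTop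
      (𝓝 (expand 2 two_ne_zero (pentagonalSeries R))) := by
    rw [WithPiTopology.tendsto_iff_coeff_tendsto] at hE1 ⊢
    intro d
    have (M : ℕ) : ∏ i ∈ Finset.range M, (1 - X ^ (2 * (i + 1)) : R⟦X⟧) =
        expand 2 two_ne_zero (∏ i ∈ Finset.range M, (1 - X ^ (i + 1))) := by
      simp only [map_prod, map_sub, map_one, map_pow, expand_X, ← pow_mul]
    simp only [this, coeff_expand]
    split_ifs
    · exact hE1 _
    · exact tendsto_const_nhds
  have h1 : Tendsto (fun M => coloredPartitionSeries R r s *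
      ∏ i ∈ Finset.range (2 * M), (1 - X ^ (i + 1)) ^ numColors r s (i + 1)) atTop (𝓝 1) := by
    rw [WithPiTopology.tendsto_iff_coeff_tendsto]
    intro d
    refine tendsto_atTop_of_eventually_const (i₀ := d) fun M hM => ?_
    exact coeff_coloredPartitionSeries_mul_prod R r s (by omega)
  have h2 := h1.mul (hE2.pow s)
  have h3 := ((hE2.pow r).mul ((hE1.comp hdouble).pow s)).const_mul (coloredPartitionSeries R r s)
  rw [one_mul] at h2
  refine tendsto_nhds_unique (h3.congr fun M => ?_) h2
  rw [mul_assoc, prod_numColors]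
  rfl

/-! ### The congruence -/

theorem pentagonalSeries_ne_zero : pentagonalSeries (ZMod 3) ≠ 0 := by
  intro h
  have h1 := coeff_pentagonalSeries_pentagonal (ZMod 3) 0
  rw [h] at h1
  simp at h1

theorem theorem1p10 (n k j : ℕ) (hjk : j ≤ k) :
    coloredPartitionCount (9 * (k - j) + 4) (9 * k + 2) (9 * n + 7) ≡ 0 [MOD 3] := by
  set E₁ := pentagonalSeries (ZMod 3) with hE₁
  set E₂ := expand 2 two_ne_zero E₁ with hE₂
  have hE₁0 : E₁ ≠ 0 := pentagonalSeries_ne_zero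
  have hE₂0 : E₂ ≠ 0 := fun h => hE₁0 <| by
    ext m
    rw [← coeff_expand_mul 2 two_ne_zero E₁ m, ← hE₂, h, map_zero, map_zero]
  set D := coloredPartitionSeries (ZMod 3) (9 * (k - j) + 4) (9 * k + 2) with hD
  set G := eulerProduct * E₂ ^ (k - j) * E₁ ^ k with hG
  have hG0 : G ≠ 0 :=
    mul_ne_zero (mul_ne_zero (mul_ne_zero hE₁0 hE₂0) (pow_ne_zero _ hE₂0)) (pow_ne_zero _ hE₁0)
  -- Multiply the generating function identity by `(E₁ E₂) ^ 7` and cancel `E₂ ^ 2`.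
  have h1 : D * G ^ 9 = eulerProduct ^ 7 * (E₂ ^ k) ^ 9 := by
    have h := coloredPartitionSeries_mul (ZMod 3) (9 * (k - j) + 4) (9 * k + 2)
    rw [← hE₁, ← hE₂, ← hD] at h
    refine mul_right_cancel₀ (pow_ne_zero 2 hE₂0) ?_
    rw [hG, eulerProduct, ← hE₁, ← hE₂]
    linear_combination (E₁ * E₂) ^ 7 * h
  rw [pow_nine_eq_expand, pow_nine_eq_expand] at h1
  have h2 : seriesSection 9 7 D * G = 0 := by
    rw [← seriesSection_mul_expand (by norm_num), h1, seriesSection_mul_expand (by norm_num),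
      seriesSection_eulerProduct_pow_seven, zero_mul]
  have h3 := (mul_eq_zero.1 h2).resolve_right hG0
  have h4 := congrArg (coeff n) h3
  rw [coeff_seriesSection, hD, coloredPartitionSeries, coeff_mk, map_zero] at h4
  exact (ZMod.natCast_eq_natCast_iff _ 0 3).1 (by rw [h4, Nat.cast_zero])
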